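/- Let $R$ be a commutative ring with $1$. Let $\mathbf{Sh}$ be the category whose objects are pairs $(P,F)$ with $P$ a small category and $F:P\to{}_R\mathrm{Mod}$ a contravariant functor; a morphism $(P,F)\to(Q,G)$ is a pair $(\gamma_1,\gamma_2)$ of a covariant functor $\gamma_1:Q\to P$ and a natural transformation $\gamma_2:F\gamma_1\to G$, and composition is $\delta\circ\gamma=(\gamma_1\circ\delta_1,\delta_2\circ\gamma_2)$. For $(P,F)\in\mathbf{Sh}$ let $\mathcal S^k(P,F)=\prod_{\sigma}F(x_0)$ ($k\ge 0$), the product over all $k$-simplices $\sigma=(x_0\to\cdots\to x_k)$ of the nerve of $P$, with differential $$(du)|_\sigma=F(x_0\to x_1)(u|_{\sigma_0})+\sum_{j=1}^{k}(-1)^j u|_{\sigma_j},$$ where $\sigma_j$ is $\sigma$ with $x_j$ omitted, and let $H^k(P,F)=H^k(\mathcal S^*(P,F))$. A morphism $\gamma$ induces $(\gamma^*u)|_\sigma=(\gamma_2)_{x_0}(u|_{\gamma_1(\sigma)})$, so that $\mathcal S^*$ and $H^k$ are covariant functors on $\mathbf{Sh}$. Let $B$ be a small category and $\xi:B\to\mathbf{Sh}$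 a bundle of sheaves, i.e. a contravariant functor, and write $\xi(x)=(E_x,F_x)$. Composing $\xi$ with $\mathcal S^q$ and with $H^q$ gives contravariant functors $\mathcal S^q$ and $\mathcal H^q_{fib}$ from $B$ to ${}_R\mathrm{Mod}$, where $\mathcal S^q(x)=\mathcal S^q(E_x,F_x)$ and $\mathcal H^q_{fib}(x)=H^q(E_x,F_x)$. Let $\mathcal K^{p,q}=\mathcal S^p(B,\mathcal S^q)$ for $p,q\ge 0$, with vertical differential $d^v:\mathcal K^{p,q-1}\to\mathcal K^{p,q}$ induced by the differentials of the complexes $\mathcal S^*(E_x,F_x)$, and horizontal differential $d^h:\mathcal K^{p-1,q}\to\mathcal K^{p,q}$ equal to $(-1)^{p+q}$ times the differential of $\mathcal S^*(B,\mathcal S^q)$. Let $\mathcal T^*$ be the total complex, $\mathcal T^n=\bigoplus_{p+q=n}\mathcal K^{p,q}$ with $d=d^h+d^v$. (If $(E,F)$ denotes the total sheaf of $\xi$, this complex is written $\mathcal T^*(E,F)$; it is determined by $\xi$ through the formulas above.) Then there is a first quadrant cohomological spectral sequence of $R$-modules $$E_2^{p,q}\cong H^p(B,\mathcal H^q_{fib})\Longrightarrow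 H^{p+q}(\mathcal T^*(E,F)).$$ That is, the differentials on the page $E_r$ ($r\ge 2$) are $d_r:E_r^{p,q}\to E_r^{p+r,q-r+1}$, and every $H^n(\mathcal T^*(E,F))$ has a decreasing filtration $H^n=\mathrm{Fil}^0\supseteq \mathrm{Fil}^1\supseteq\cdots\supseteq \mathrm{Fil}^{n+1}=0$ such that for all $p,q\ge 0$ and all sufficiently large $r$ the differentials into and out of $E_r^{p,q}$ vanish and $E_r^{p,q}=E_\infty^{p,q}\cong \mathrm{Fil}^pH^{p+q}/\mathrm{Fil}^{p+1}H^{p+q}$. -/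

import Mathlib

open CategoryTheory

universe u w

noncomputable section

/-- An object `(P, F)` of the category of sheaves on small categories: a small category `P`
together with a contravariant functor `F` from `P` to `R`-modules. -/
structure Sh (R : Type w) [CommRing R] where
  cat : Type u
  [catInst : SmallCategory cat]
  sheaf : catᵒᵖ ⥤ ModuleCat.{u} R

attribute [instance] Sh.catInst

namespace Sh

variable {R : Type w} [CommRing R]

/-- A morphism `(P, F) → (Q, G)`: a covariant functor `γ₁ : Q ⥤ P` (`fst`) and a natural
transformation `γ₂ : F γ₁ ⟶ G` (`snd`). -/
@[ext]
structure Hom (X Y : Sh.{u} R) where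
  fst : Y.cat ⥤ X.cat
  snd : fst.op ⋙ X.sheaf ⟶ Y.sheaf

/-- Composition is `(γ₁ ∘ δ₁, δ₂ ∘ γ₂)`. -/
instance : Category (Sh.{u} R) where
  Hom := Hom
  id X := { fst := 𝟭 X.cat, snd := 𝟙 X.sheaf }
  comp {_ _ _} γ δ :=
    { fst := δ.fst ⋙ γ.fst
      snd := Functor.whiskerLeft δ.fst.op γ.snd ≫ δ.snd }
  id_comp {_ _} γ := by
    refine Hom.ext rfl (heq_of_eq ?_)
    ext x : 2
    exact Category.id_comp _
  comp_id {_ _} γ := by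
    refine Hom.ext rfl (heq_of_eq ?_)
    ext x : 2
    exact Category.comp_id _
  assoc {_ _ _ _} γ δ ε := by
    refine Hom.ext rfl (heq_of_eq ?_)
    ext x : 2
    exact (Category.assoc (obj := ModuleCat.{u} R) _ _ _)

/-- `F(σ) = F(x₀)` for a simplex `σ = x₀ → ⋯ → xₙ` of the nerve of `P`. -/
abbrev atSimplex (X : Sh.{u} R) {n : ℕ} (σ : ComposableArrows X.cat n) : ModuleCat.{u} R :=
  X.sheaf.obj (Opposite.op (σ.obj 0))

/-- The simplex `x_{θ 0} → ⋯ → x_{θ m}` obtained from `σ = x₀ → ⋯ → xₙ` and a monotone map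
`θ : [m] → [n]`; for `θ` the `j`-th coface map it is the face `σ_j` omitting `x_j`. -/
abbrev pullSimplex {P : Type u} [SmallCategory P] {a b : SimplexCategory} (θ : a ⟶ b)
    (σ : ComposableArrows P b.len) : ComposableArrows P a.len :=
  θ.toOrderHom.monotone.functor ⋙ σ

/-- The map `F(x₀ → x_{θ 0}) : F(x_{θ 0}) → F(x₀)`, the arrow being the composite in `σ`. -/
abbrev faceMap (X : Sh.{u} R) {a b : SimplexCategory} (θ : a ⟶ b)
    (σ : ComposableArrows X.cat b.len) :
    X.atSimplex (pullSimplex θ σ) ⟶ X.atSimplex σ :=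
  X.sheaf.map (σ.map (homOfLE (Fin.zero_le (θ.toOrderHom 0)))).op

/-- The cosimplicial module `[n] ↦ ∏_σ F(σ)`, the product being over all `n`-simplices of the
nerve of `P`. -/
def cosimplicial (X : Sh.{u} R) : CosimplicialObject (ModuleCat.{u} R) where
  obj a := ModuleCat.of R (∀ σ : ComposableArrows X.cat a.len, X.atSimplex σ)
  map {a b} θ := ModuleCat.ofHom <| LinearMap.pi fun σ =>
    (X.faceMap θ σ).hom ∘ₗ LinearMap.proj (pullSimplex θ σ)
  map_id a := by
    refine ModuleCat.hom_ext (LinearMap.ext fun u => funext fun σ => ?_)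
    have h : X.faceMap (𝟙 a) σ = 𝟙 _ := by
      refine Eq.trans ?_ (X.sheaf.map_id _)
      refine congrArg X.sheaf.map (congrArg Quiver.Hom.op ?_)
      exact σ.map_id 0
    exact congrArg (fun f => f.hom (u σ)) h
  map_comp {a b c} θ η := by
    refine ModuleCat.hom_ext (LinearMap.ext fun u => funext fun σ => ?_)
    have h : X.faceMap (θ ≫ η) σ = X.faceMap θ (pullSimplex η σ) ≫ X.faceMap η σ := by
      refine Eq.trans ?_ (X.sheaf.map_comp _ _)
      refine congrArg X.sheaf.map (Eq.trans (congrArg Quiver.Hom.op ?_) op_comp)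
      exact (congrArg σ.map (Subsingleton.elim _ _)).trans (σ.map_comp _ _)
    exact congrArg (fun f => f.hom (u (pullSimplex (θ ≫ η) σ))) h

/-- The functoriality `(γ^* u)|_σ = (γ₂)_{x₀} (u|_{γ₁(σ)})` of the cochain modules. -/
def cosimplicialFunctor : Sh.{u} R ⥤ CosimplicialObject (ModuleCat.{u} R) where
  obj X := X.cosimplicial
  map {X Y} γ :=
    { app a := ModuleCat.ofHom (X := X.cosimplicial.obj a) (Y := Y.cosimplicial.obj a) <|
        LinearMap.pi fun σ : ComposableArrows Y.cat a.len =>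
          (γ.snd.app (Opposite.op (σ.obj 0))).hom ∘ₗ
            LinearMap.proj (R := R) (φ := fun τ : ComposableArrows X.cat a.len => X.atSimplex τ)
              (σ ⋙ γ.fst)
      naturality a b θ := by
        refine ModuleCat.hom_ext (LinearMap.ext fun u => funext fun σ => ?_)
        exact congrArg (fun f => f.hom (u (pullSimplex θ (σ ⋙ γ.fst))))
          (γ.snd.naturality (σ.map (homOfLE (Fin.zero_le (θ.toOrderHom 0)))).op) }
  map_id _ := rfl
  map_comp _ _ := rfl

/-- The cochain complex functor `𝒮^*`: the modules are `𝒮^k(P, F) = ∏_σ F(σ)` over the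
`k`-simplices `σ` of the nerve, with differential the alternating sum of the coface maps
(`Sh.cochains_d_apply`). -/
def cochains : Sh.{u} R ⥤ CochainComplex (ModuleCat.{u} R) ℕ :=
  cosimplicialFunctor ⋙ AlgebraicTopology.alternatingCofaceMapComplex (ModuleCat.{u} R)

/-- The explicit differential: `(d u)|_σ = ∑_j (-1)^j F(σ_j ⊆ σ)(u|_{σ_j})`. -/
theorem cochains_d_apply (X : Sh.{u} R) (n : ℕ)
    (u : ∀ τ : ComposableArrows X.cat n, X.atSimplex τ)
    (σ : ComposableArrows X.cat (n + 1)) :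
    (((cochains.obj X).d n (n + 1)).hom u : ∀ σ : ComposableArrows X.cat (n + 1), X.atSimplex σ) σ
      = ∑ j : Fin (n + 2), (-1 : ℤ) ^ (j : ℕ) •
          (X.faceMap (SimplexCategory.δ j) σ).hom (u (pullSimplex (SimplexCategory.δ j) σ)) := by
  have h : (cochains.obj X).d n (n + 1) =
      AlgebraicTopology.AlternatingCofaceMapComplex.objD X.cosimplicial n :=
    CochainComplex.of_d (X := fun n => X.cosimplicial.obj (SimplexCategory.mk n))
      (d := AlgebraicTopology.AlternatingCofaceMapComplex.objD X.cosimplicial) (j := n)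
  let ev : (X.cosimplicial.obj (SimplexCategory.mk n) ⟶
      X.cosimplicial.obj (SimplexCategory.mk (n + 1))) →+ X.atSimplex σ :=
    { toFun f := (f.hom u : ∀ σ : ComposableArrows X.cat (n + 1), X.atSimplex σ) σ
      map_zero' := rfl
      map_add' _ _ := rfl }
  refine (congrArg ev h).trans ((map_sum ev _ _).trans (Finset.sum_congr rfl fun j _ => ?_))
  rw [map_zsmul]
  rfl

/-- The cohomology functor `H^q : (P, F) ↦ H^q(P, F) = H^q(𝒮^*(P, F))`. -/
def cohomology (q : ℕ) : Sh.{u} R ⥤ ModuleCat.{u} R :=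
  cochains ⋙ HomologicalComplex.homologyFunctor (ModuleCat.{u} R) (ComplexShape.up ℕ) q

/-- The object `(B, G)` of `Sh`, functorially in the sheaf `G` on a fixed category `B`; a natural
transformation `α` induces the morphism `(id_B, α)`. -/
def sheafOn (B : Type u) [SmallCategory B] : (Bᵒᵖ ⥤ ModuleCat.{u} R) ⥤ Sh.{u} R where
  obj G := { cat := B, sheaf := G }
  map α := { fst := 𝟭 B, snd := α }

end Sh

/-- A bundle of sheaves with base `B`: a contravariant functor from `B` to `Sh`. -/
abbrev SheafBundle (R : Type w) [CommRing R] (B : Type u) [SmallCategory B] :=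
  Bᵒᵖ ⥤ Sh.{u} R

namespace SheafBundle

variable {R : Type w} [CommRing R] {B : Type u} [SmallCategory B] (ξ : SheafBundle R B)

/-- The `q`-cochain sheaf `𝒮^q` on `B`, sending `x` to `𝒮^q(E_x, F_x)`. -/
def cochainSheaf (q : ℕ) : Bᵒᵖ ⥤ ModuleCat.{u} R :=
  ξ ⋙ Sh.cochains ⋙ HomologicalComplex.eval (ModuleCat.{u} R) (ComplexShape.up ℕ) q

/-- The differentials `𝒮^q(E_x, F_x) → 𝒮^{q'}(E_x, F_x)` as a morphism of sheaves on `B`. -/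
def cochainSheafD (q q' : ℕ) : ξ.cochainSheaf q ⟶ ξ.cochainSheaf q' where
  app x := (Sh.cochains.obj (ξ.obj x)).d q q'
  naturality _ _ f := (Sh.cochains.map (ξ.map f)).comm q q'

/-- The cohomology of the fibres `ℋ^q_fib`, the sheaf on `B` sending `x` to `H^q(E_x, F_x)`. -/
def fibreCohomology (q : ℕ) : Bᵒᵖ ⥤ ModuleCat.{u} R :=
  ξ ⋙ Sh.cohomology q

/-- The row `𝒮^*(B, 𝒮^q)`, with its unsigned differential. -/
def row (q : ℕ) : CochainComplex (ModuleCat.{u} R) ℕ :=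
  Sh.cochains.obj ((Sh.sheafOn B).obj (ξ.cochainSheaf q))

/-- The morphism of rows `𝒮^*(B, 𝒮^q) → 𝒮^*(B, 𝒮^{q'})` induced by the differential of sheaves
`𝒮^q → 𝒮^{q'}` on `B`. -/
def rowMap (q q' : ℕ) : ξ.row q ⟶ ξ.row q' :=
  Sh.cochains.map ((Sh.sheafOn B).map (ξ.cochainSheafD q q'))

/-- The bicomplex module `𝒦^{p,q} = 𝒮^p(B, 𝒮^q)`. -/
abbrev bicomplex (p q : ℕ) : ModuleCat.{u} R :=
  (ξ.row q).X p

/-- The vertical differential `d^v : 𝒮^p(B, 𝒮^q) → 𝒮^p(B, 𝒮^{q+1})`, induced by the differential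
`𝒮^q → 𝒮^{q+1}` of sheaves on `B`. -/
def dVert (p q : ℕ) : ξ.bicomplex p q ⟶ ξ.bicomplex p (q + 1) :=
  (ξ.rowMap q (q + 1)).f p

/-- The horizontal differential `d^h : 𝒮^p(B, 𝒮^q) → 𝒮^{p+1}(B, 𝒮^q)`, with the sign
`(-1)^{(p+1)+q}` that makes the squares anticommute. -/
def dHor (p q : ℕ) : ξ.bicomplex p q ⟶ ξ.bicomplex (p + 1) q :=
  (-1 : ℤ) ^ (p + 1 + q) • (ξ.row q).d p (p + 1)

theorem dVert_dVert (p q : ℕ) : ξ.dVert p q ≫ ξ.dVert p (q + 1) = 0 := by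
  have h : (Sh.sheafOn B).map (ξ.cochainSheafD q (q + 1)) ≫
      (Sh.sheafOn B).map (ξ.cochainSheafD (q + 1) (q + 2)) =
      (Sh.sheafOn B).map (0 : ξ.cochainSheaf q ⟶ ξ.cochainSheaf (q + 2)) := by
    rw [← Functor.map_comp]
    congr 1
    ext x : 2
    exact (Sh.cochains.obj (ξ.obj x)).d_comp_d _ _ _
  have h' := congrArg (fun f => (Sh.cochains.map f).f p) h
  simp only [Functor.map_comp, HomologicalComplex.comp_f] at h'
  refine h'.trans ?_
  refine ModuleCat.hom_ext (LinearMap.ext fun u => funext fun σ => ?_)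
  rfl

theorem dHor_dHor (p q : ℕ) : ξ.dHor p q ≫ ξ.dHor (p + 1) q = 0 := by
  simp [dHor]

theorem dHor_dVert (p q : ℕ) :
    ξ.dHor p q ≫ ξ.dVert (p + 1) q + ξ.dVert p q ≫ ξ.dHor p (q + 1) = 0 := by
  have h := (ξ.rowMap q (q + 1)).comm p (p + 1)
  simp only [dHor, dVert, Preadditive.comp_zsmul, Preadditive.zsmul_comp]
  rw [h, ← add_smul]
  have : (-1 : ℤ) ^ (p + 1 + q) + (-1) ^ (p + 1 + (q + 1)) = 0 := by ring
  rw [this, zero_smul]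

/-- The module `𝒯^n = ⨁_{p+q=n} 𝒦^{p,q}` of the total complex; the sum is finite, so it is written
as the product of its summands. -/
abbrev totalX (n : ℕ) : ModuleCat.{u} R :=
  ModuleCat.of R (∀ i : Finset.HasAntidiagonal.antidiagonal n, ξ.bicomplex i.1.1 i.1.2)

/-- The projection `𝒯^n → 𝒦^{p,q}` for `p + q = n`. -/
def totalProj {n : ℕ} (p q : ℕ) (h : p + q = n) : ξ.totalX n ⟶ ξ.bicomplex p q :=
  ModuleCat.ofHom <| LinearMap.proj (R := R)
    (φ := fun i : Finset.HasAntidiagonal.antidiagonal n => ξ.bicomplex i.1.1 i.1.2)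
    ⟨(p, q), Finset.HasAntidiagonal.mem_antidiagonal.mpr h⟩

/-- The component of `d^h` with values in `𝒦^{p,q}`. -/
def totalHor {n : ℕ} : ∀ p q : ℕ, p + q = n + 1 → (ξ.totalX n ⟶ ξ.bicomplex p q)
  | 0, _, _ => 0
  | p + 1, q, h => ξ.totalProj p q (by omega) ≫ ξ.dHor p q

/-- The component of `d^v` with values in `𝒦^{p,q}`. -/
def totalVert {n : ℕ} : ∀ p q : ℕ, p + q = n + 1 → (ξ.totalX n ⟶ ξ.bicomplex p q)
  | _, 0, _ => 0
  | p, q + 1, h => ξ.totalProj p q (by omega) ≫ ξ.dVert p q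

/-- The differential `d = d^h + d^v` of the total complex. -/
def totalD (n : ℕ) : ξ.totalX n ⟶ ξ.totalX (n + 1) :=
  ModuleCat.ofHom <| LinearMap.pi fun i =>
    (ξ.totalHor i.1.1 i.1.2 (Finset.HasAntidiagonal.mem_antidiagonal.mp i.2) +
      ξ.totalVert i.1.1 i.1.2 (Finset.HasAntidiagonal.mem_antidiagonal.mp i.2)).hom

theorem totalD_proj {n : ℕ} (p q : ℕ) (h : p + q = n + 1) :
    ξ.totalD n ≫ ξ.totalProj p q h = ξ.totalHor p q h + ξ.totalVert p q h :=
  rfl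

theorem totalHor_dHor {n : ℕ} (p q : ℕ) (h : p + q = n + 1) :
    ξ.totalHor p q h ≫ ξ.dHor p q = 0 := by
  cases p <;> simp [totalHor, dHor_dHor]

theorem totalVert_dVert {n : ℕ} (p q : ℕ) (h : p + q = n + 1) :
    ξ.totalVert p q h ≫ ξ.dVert p q = 0 := by
  cases q <;> simp [totalVert, dVert_dVert]

theorem totalD_totalD (n : ℕ) : ξ.totalD n ≫ ξ.totalD (n + 1) = 0 := by
  have key : ∀ (p q : ℕ) (h : p + q = n + 2),
      ξ.totalD n ≫ ξ.totalD (n + 1) ≫ ξ.totalProj p q h = 0 := by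
    intro p q h
    rw [totalD_proj]
    rcases p with _ | p <;> rcases q with _ | q
    · omega
    · have e : ξ.totalD n ≫ ξ.totalProj 0 q (by omega) ≫ ξ.dVert 0 q = 0 := by
        rw [← Category.assoc, totalD_proj]
        simp [totalHor, totalVert_dVert]
      simpa [totalHor, totalVert] using e
    · have e : ξ.totalD n ≫ ξ.totalProj p 0 (by omega) ≫ ξ.dHor p 0 = 0 := by
        rw [← Category.assoc, totalD_proj]
        simp [totalVert, totalHor_dHor]
      simpa [totalHor, totalVert] using e
    · rw [totalHor, totalVert, Preadditive.comp_add, ← Category.assoc, ← Category.assoc,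
        totalD_proj, totalD_proj, Preadditive.add_comp, Preadditive.add_comp,
        totalHor_dHor, totalVert_dVert, zero_add, add_zero, totalHor, totalVert,
        Category.assoc, Category.assoc, ← Preadditive.comp_add, add_comm (_ ≫ _),
        dHor_dVert, Limits.comp_zero]
  refine ModuleCat.hom_ext (LinearMap.ext fun u => funext fun i => ?_)
  exact congrArg (fun f => f.hom u)
    (key i.1.1 i.1.2 (Finset.HasAntidiagonal.mem_antidiagonal.mp i.2))

/-- The total complex `𝒯^*` of the bicomplex `𝒦`. -/
def totalComplex : CochainComplex (ModuleCat.{u} R) ℕ :=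
  CochainComplex.of ξ.totalX ξ.totalD ξ.totalD_totalD

end SheafBundle

/-- A first quadrant cohomological spectral sequence `E` of `R`-modules converges to the graded
module `H`: every `H^n` has a decreasing filtration `H^n = Fil⁰ ⊇ Fil¹ ⊇ ⋯ ⊇ Fil^{n+1} = 0`, and
for all `(p, q)` and all large `r` the differentials of the page `E_r` into and out of position
`(p, q)` vanish (so that `E_r^{p,q} = E_∞^{p,q}`) and
`E_r^{p,q} ≅ Fil^p H^{p+q} / Fil^{p+1} H^{p+q}`. -/
def ConvergesTo {R : Type w} [CommRing R]
    (E : E₂CohomologicalSpectralSequenceNat (ModuleCat.{u} R)) (H : ℕ → ModuleCat.{u} R) : Prop :=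
  ∃ Fil : ∀ n : ℕ, ℕ → Submodule R (H n),
    (∀ n, Antitone (Fil n)) ∧ (∀ n, Fil n 0 = ⊤) ∧ (∀ n, Fil n (n + 1) = ⊥) ∧
    ∀ p q : ℕ, ∃ r₁ : ℤ, ∀ (r : ℤ) (hr : 2 ≤ r), r₁ ≤ r →
      (∀ i, (E.page r hr).d i (p, q) = 0) ∧ (∀ i, (E.page r hr).d (p, q) i = 0) ∧
      Nonempty ((E.page r hr).X (p, q) ≅
        ModuleCat.of R (Fil (p + q) p ⧸ (Fil (p + q) (p + 1)).submoduleOf (Fil (p + q) p)))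

end

/-!
The spectral sequence is that of the total complex of `𝒦^{p,q} = 𝒮^p(B, 𝒮^q)`, filtered
by columns.

All bidegrees are kept inside one module, that of families indexed by `ℕ × ℕ`, with the total
differential `d` and the submodules `F n p` of families concentrated in total degree `n` and
columns `≥ p`, for integers `n` and `p`. For such a filtered differential module
(`FilteredDiff`) one takes `E_r^p = Z_r^p / B_r^p`, where `Z_r^p = {x ∈ F^p | d x ∈ F^{p+r}}` and
`B_r^p = d Z_{r-1}^{p-r+1} + Z_{r-1}^{p+1}`. The kernel of `d_r` on `E_r^p` is the image of
`Z_{r+1}^p` (`FilteredDiff.dE_eq_zero_iff`), and an element of `Z_{r+1}^p` becomes a `d_r`-boundary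
exactly when it lies in `B_{r+1}^p` (`FilteredDiff.mem_B_iff_exists_dE`); so the homology of `E_r`
is `E_{r+1}`. In the first quadrant `F n p` vanishes for `p > n` and is the whole part of degree
`n` for `p ≤ 0`, so for large `r` one has `Z_r^p = F^p ∩ ker d` and
`B_r^p = (F^p ∩ im d) + (F^{p+1} ∩ ker d)`, and their quotient is the graded piece of the filtration
of the cohomology (`FilteredDiff.IsFirstQuadrant.convergesTo`).

For the second page, an element of `Z_2^p` has as its entry in column `p` a vertical cycle, that is,
a cochain on `B` with values in the sheaf of fibrewise cocycles. Since `𝒮^p(B, -)` is a product over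
simplices, it is exact in the sheaf; hence the vertical cycles modulo the vertical boundaries form
`𝒮^p(B, ℋ^q_fib)`. The entry in column `p + 1` witnesses that the class of the first entry is a
cocycle there, and `B_2^p` consists of the elements whose class is a coboundary
(`DoubleComplex.nonempty_iso_E_two`). The sign `(-1)^{p+q}` in the horizontal differential changes
neither kernels nor images.
-/

noncomputable section

/-! ### Homology of complexes of modules through representatives -/

section Homology

variable {R : Type w} [CommRing R]

/-- Homology computed through representatives: if `π : N → K^j` has the module of cycles as its
image, then `N` maps onto the homology at `j`, and the kernel consists of the elements whose image
is a boundary. Quantifying over all `j'` avoids a case distinction on whether `j` has a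
predecessor or a successor, since differentials between unrelated indices vanish. -/
theorem exists_linearMap_homology {κ : Type*} {c : ComplexShape κ}
    (K : HomologicalComplex (ModuleCat.{u} R) c) (j : κ)
    {N : Type*} [AddCommGroup N] [Module R N] (π : N →ₗ[R] K.X j) (b : Submodule R N)
    (hπ : ∀ y : K.X j, (∃ x, π x = y) ↔ ∀ j', (K.d j j').hom y = 0)
    (hb : ∀ x : N, x ∈ b ↔ ∃ j', ∃ z : K.X j', (K.d j' j).hom z = π x) :
    ∃ h : N →ₗ[R] K.homology j, Function.Surjective h ∧ LinearMap.ker h = b := by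
  have hker : ∀ x, π x ∈ LinearMap.ker (K.sc j).g.hom := fun x => (hπ _).1 ⟨x, rfl⟩ _
  let e : K.homology j ≃ₗ[R]
      (LinearMap.ker (K.sc j).g.hom ⧸ LinearMap.range (K.sc j).moduleCatToCycles) :=
    (K.sc j).moduleCatHomologyIso.toLinearEquiv
  refine ⟨e.symm.toLinearMap ∘ₗ (Submodule.mkQ _) ∘ₗ π.codRestrict _ hker, ?_, ?_⟩
  · refine e.symm.surjective.comp ((Submodule.mkQ_surjective _).comp ?_)
    rintro ⟨y, hy⟩
    have hy' : ∀ j', (K.d j j').hom y = 0 := by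
      intro j'
      by_cases hj : c.Rel j j'
      · obtain rfl := c.next_eq' hj
        exact hy
      · rw [K.shape _ _ hj]
        rfl
    obtain ⟨x, hx⟩ := (hπ y).2 hy'
    exact ⟨x, Subtype.ext hx⟩
  · ext x
    rw [hb, LinearMap.mem_ker]
    refine (e.symm.map_eq_zero_iff.trans (Submodule.Quotient.mk_eq_zero _)).trans ?_
    constructor
    · rintro ⟨z, hz⟩
      exact ⟨_, z, congrArg Subtype.val hz⟩
    · rintro ⟨j', z, hz⟩
      by_cases hj : c.Rel j' j
      · obtain rfl := c.prev_eq' hj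
        exact ⟨z, Subtype.ext hz⟩
      · rw [K.shape _ _ hj] at hz
        exact ⟨0, Subtype.ext ((map_zero _).trans hz)⟩

/-- The isomorphism induced by the surjection of `exists_linearMap_homology`. -/
theorem nonempty_iso_homology {κ : Type*} {c : ComplexShape κ}
    (K : HomologicalComplex (ModuleCat.{u} R) c) (j : κ)
    {N : Type u} [AddCommGroup N] [Module R N] (π : N →ₗ[R] K.X j) (b : Submodule R N)
    (hπ : ∀ y : K.X j, (∃ x, π x = y) ↔ ∀ j', (K.d j j').hom y = 0)
    (hb : ∀ x : N, x ∈ b ↔ ∃ j', ∃ z : K.X j', (K.d j' j).hom z = π x) :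
    Nonempty (K.homology j ≅ ModuleCat.of R (N ⧸ b)) := by
  obtain ⟨h, hs, hk⟩ := exists_linearMap_homology K j π b hπ hb
  subst hk
  exact ⟨(h.quotKerEquivOfSurjective hs).symm.toModuleIso⟩

end Homology

/-! ### The spectral sequence of a filtered differential module -/

/-- A differential module `(M, d)` with submodules `F n p`, to be thought of as the `p`-th
filtration step of the part of degree `n`. Keeping all degrees inside one module makes the degree
equalities between the terms of a spectral sequence plain propositions. -/
structure FilteredDiff (R : Type w) [CommRing R] (M : Type u) [AddCommGroup M] [Module R M] where
  d : M →ₗ[R] M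
  F : ℤ → ℤ → Submodule R M
  d_d : ∀ x, d (d x) = 0
  F_anti : ∀ n, Antitone (F n)
  d_mem : ∀ n p x, x ∈ F n p → d x ∈ F (n + 1) p

namespace FilteredDiff

variable {R : Type w} [CommRing R] {M : Type u} [AddCommGroup M] [Module R M]
  (A : FilteredDiff R M)

/-- The approximate cycles `Z_r^p = {x ∈ F^p | d x ∈ F^{p+r}}` in degree `n`. -/
def Z (r n p : ℤ) : Submodule R M := A.F n p ⊓ (A.F (n + 1) (p + r)).comap A.d

/-- The approximate boundaries `B_r^p = d Z_{r-1}^{p-r+1} + Z_{r-1}^{p+1}` in degree `n`. -/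
def B (r n p : ℤ) : Submodule R M :=
  (A.Z (r - 1) (n - 1) (p - r + 1)).map A.d ⊔ A.Z (r - 1) n (p + 1)

variable {A}

theorem mem_Z {r n p : ℤ} {x : M} :
    x ∈ A.Z r n p ↔ x ∈ A.F n p ∧ A.d x ∈ A.F (n + 1) (p + r) := Iff.rfl

theorem mem_B {r n p : ℤ} {x : M} :
    x ∈ A.B r n p ↔ ∃ y ∈ A.Z (r - 1) (n - 1) (p - r + 1), ∃ z ∈ A.Z (r - 1) n (p + 1),
      A.d y + z = x := by
  simp [B, Submodule.mem_sup]

theorem F_le {n p p' : ℤ} (h : p ≤ p') {x : M} (hx : x ∈ A.F n p') : x ∈ A.F n p :=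
  A.F_anti n h hx

theorem Z_mono {r r' n p p' : ℤ} (h : p ≤ p') (h' : p + r ≤ p' + r') {x : M}
    (hx : x ∈ A.Z r' n p') : x ∈ A.Z r n p :=
  ⟨F_le h hx.1, F_le h' hx.2⟩

theorem mem_Z_of_d_eq_zero {r n p : ℤ} {x : M} (hx : x ∈ A.F n p) (h : A.d x = 0) :
    x ∈ A.Z r n p :=
  mem_Z.2 ⟨hx, h ▸ zero_mem _⟩

variable (A) in
/-- The term `E_r^p = Z_r^p / B_r^p` in degree `n`. -/
abbrev E (r n p : ℤ) : Type u := A.Z r n p ⧸ (A.B r n p).submoduleOf (A.Z r n p)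

variable (A) in
/-- The class in `E_r^p` of an approximate cycle. -/
abbrev mkE (r n p : ℤ) : A.Z r n p →ₗ[R] A.E r n p := Submodule.mkQ _

theorem mkE_eq_zero {r n p : ℤ} (x : A.Z r n p) : A.mkE r n p x = 0 ↔ x.1 ∈ A.B r n p := by
  rw [Submodule.mkQ_apply, Submodule.Quotient.mk_eq_zero]
  rfl

theorem mkE_surjective {r n p : ℤ} (y : A.E r n p) : ∃ x, A.mkE r n p x = y :=
  Submodule.mkQ_surjective _ y

theorem d_mem_Z {r n p n' p' : ℤ} (h : n' = n + 1 ∧ p' = p + r) (x : M) (hx : x ∈ A.Z r n p) :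
    A.d x ∈ A.Z r n' p' := by
  obtain ⟨rfl, rfl⟩ := h
  exact mem_Z_of_d_eq_zero hx.2 (A.d_d x)

theorem d_mem_B {r n p n' p' : ℤ} (h : n' = n + 1 ∧ p' = p + r) (x : M) (hx : x ∈ A.B r n p) :
    A.d x ∈ A.B r n' p' := by
  obtain ⟨rfl, rfl⟩ := h
  obtain ⟨y, -, z, hz, rfl⟩ := mem_B.1 hx
  refine mem_B.2 ⟨z, ?_, 0, zero_mem _, by simp [A.d_d]⟩
  convert hz using 2 <;> ring

open Classical in
variable (A) in
/-- The differential `d_r : E_r^p → E_r^{p+r}` induced by `d`. It is defined between any two terms,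
as zero unless the second is the target of the `r`-th differential on the first. -/
def dE (r n p n' p' : ℤ) : A.E r n p →ₗ[R] A.E r n' p' :=
  if h : n' = n + 1 ∧ p' = p + r then
    Submodule.mapQ _ _ (A.d.restrict (d_mem_Z h)) fun x hx => d_mem_B h x.1 hx
  else 0

theorem dE_mkE {r n p n' p' : ℤ} (h : n' = n + 1 ∧ p' = p + r) (x : A.Z r n p) :
    A.dE r n p n' p' (A.mkE r n p x) = A.mkE r n' p' ⟨A.d x, d_mem_Z h x.1 x.2⟩ := by
  rw [dE, dif_pos h]
  rfl

theorem dE_dE {r n p n' p' n'' p'' : ℤ} (y : A.E r n p) :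
    A.dE r n' p' n'' p'' (A.dE r n p n' p' y) = 0 := by
  obtain ⟨x, rfl⟩ := mkE_surjective y
  by_cases h : n' = n + 1 ∧ p' = p + r
  · by_cases h' : n'' = n' + 1 ∧ p'' = p' + r
    · rw [dE_mkE h, dE_mkE h', mkE_eq_zero]
      simp only [A.d_d, zero_mem]
    · rw [dE, dif_neg h']
      rfl
  · have h0 : A.dE r n p n' p' = 0 := by rw [dE, dif_neg h]
    rw [h0, LinearMap.zero_apply, map_zero]

theorem Z_succ_le {r r' n p : ℤ} (hr : r + 1 = r') : A.Z r' n p ≤ A.Z r n p :=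
  fun _ hx => Z_mono le_rfl (by omega) hx

variable (A) in
/-- The map `Z_{r+1}^p → E_r^p`, whose image is the kernel of `d_r`. -/
def toE {r r' : ℤ} (hr : r + 1 = r') (n p : ℤ) : A.Z r' n p →ₗ[R] A.E r n p :=
  A.mkE r n p ∘ₗ Submodule.inclusion (Z_succ_le hr)

/-- The kernel of `d_r` is the image of `Z_{r+1}`: if `d x` is an approximate boundary `d a + z`,
then `x - a` has the same class as `x` and its differential `z` lies one step deeper. -/
theorem dE_eq_zero_iff {r r' n p n' p' : ℤ} (hr : r + 1 = r') (h : n' = n + 1 ∧ p' = p + r)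
    (y : A.E r n p) : A.dE r n p n' p' y = 0 ↔ ∃ x, A.toE hr n p x = y := by
  obtain ⟨rfl, rfl⟩ := h
  subst hr
  constructor
  · intro hy
    obtain ⟨x, rfl⟩ := mkE_surjective y
    rw [dE_mkE ⟨rfl, rfl⟩, mkE_eq_zero, mem_B] at hy
    obtain ⟨a, ha, z, hz, e⟩ := hy
    have ha' : a ∈ A.Z (r - 1) n (p + 1) := by convert ha using 2 <;> ring
    have hxa : A.d (x - a) = z := by
      rw [map_sub]
      exact sub_eq_of_eq_add' e.symm
    have hxZ : (x - a : M) ∈ A.Z (r + 1) n p := by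
      refine mem_Z.2 ⟨sub_mem x.2.1 (F_le (by omega) ha'.1), ?_⟩
      rw [hxa]
      exact F_le (by omega) hz.1
    refine ⟨⟨x - a, hxZ⟩, ?_⟩
    · rw [← sub_eq_zero, toE, LinearMap.comp_apply, ← map_sub, mkE_eq_zero]
      refine mem_B.2 ⟨0, zero_mem _, -a, neg_mem ha', ?_⟩
      simp
  · rintro ⟨x, rfl⟩
    rw [toE, LinearMap.comp_apply, dE_mkE ⟨rfl, rfl⟩, mkE_eq_zero]
    exact mem_B.2 ⟨0, zero_mem _, A.d x,
      mem_Z_of_d_eq_zero (F_le (by omega) x.2.2) (A.d_d _), by simp⟩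

/-- The elements of `Z_{r+1}` whose class in `E_r` is a `d_r`-boundary are those of `B_{r+1}`. -/
theorem mem_B_iff_exists_dE {r r' n p n' p' : ℤ} (hr : r + 1 = r') (h : n = n' + 1 ∧ p = p' + r)
    (x : A.Z r' n p) : x.1 ∈ A.B r' n p ↔ ∃ y, A.dE r n' p' n p y = A.toE hr n p x := by
  obtain ⟨rfl, rfl⟩ := h
  subst hr
  constructor
  · intro hx
    obtain ⟨y, hy, z, hz, e⟩ := mem_B.1 hx
    refine ⟨A.mkE _ _ _ ⟨y, ?_⟩, ?_⟩
    · convert hy using 2 <;> ring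
    · rw [dE_mkE ⟨rfl, rfl⟩, ← sub_eq_zero, toE, LinearMap.comp_apply, ← map_sub, mkE_eq_zero]
      refine mem_B.2 ⟨0, zero_mem _, -z, neg_mem (Z_mono le_rfl (by omega) hz), ?_⟩
      simp [← e]
  · rintro ⟨y, hy⟩
    obtain ⟨y, rfl⟩ := mkE_surjective y
    rw [dE_mkE ⟨rfl, rfl⟩, eq_comm, ← sub_eq_zero, toE, LinearMap.comp_apply, ← map_sub,
      mkE_eq_zero, mem_B] at hy
    obtain ⟨a, ha, z, hz, e⟩ := hy
    have ha' : a ∈ A.F n' (p' + 1) := by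
      rw [show n' = n' + 1 - 1 by ring, show p' + 1 = p' + r - r + 1 by ring]
      exact ha.1
    have e' : A.d (y.1 + a) + z = x.1 := by
      have e2 : A.d a + z = x.1 - A.d y.1 := e
      rw [map_add, add_assoc, e2, add_sub_cancel]
    have hda : A.d (y.1 + a) ∈ A.F (n' + 1) (p' + r) := by
      rw [eq_sub_of_add_eq e']
      exact sub_mem x.2.1 (F_le (by omega) hz.1)
    refine mem_B.2 ⟨y.1 + a, mem_Z.2 ⟨?_, ?_⟩, z, mem_Z.2 ⟨hz.1, ?_⟩, e'⟩
    · rw [add_sub_cancel_right]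
      exact F_le (by omega) (add_mem y.2.1 (F_le (p := p') (by omega) ha'))
    · rw [sub_add_cancel]
      exact F_le (by omega) hda
    · rw [eq_sub_of_add_eq' e', map_sub, A.d_d, sub_zero]
      exact F_le (by omega) x.2.2

/-- The filtration is that of a first quadrant object: in degree `n` it is exhausted at step `0`
and vanishes from step `n + 1` on. -/
structure IsFirstQuadrant (A : FilteredDiff R M) : Prop where
  bot : ∀ n p, n < p → A.F n p = ⊥
  top : ∀ n p, p ≤ 0 → A.F n p ≤ A.F n 0

theorem IsFirstQuadrant.d_eq_zero (hA : A.IsFirstQuadrant) {r n p : ℤ} {x : M}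
    (hx : x ∈ A.Z r n p) (h : n + 1 < p + r) : A.d x = 0 := by
  have hd := (mem_Z.1 hx).2
  rwa [hA.bot _ _ h, Submodule.mem_bot] at hd

theorem IsFirstQuadrant.subsingleton_of_lt (hA : A.IsFirstQuadrant) {r n p : ℤ} (h : n < p) :
    Subsingleton (A.E r n p) := by
  refine subsingleton_of_forall_eq 0 fun y => ?_
  obtain ⟨⟨x, hx⟩, rfl⟩ := mkE_surjective y
  rw [mkE_eq_zero]
  obtain rfl : x = 0 := by simpa [hA.bot n p h] using hx.1
  exact zero_mem _

/-- In columns `p < 0` the filtration is constant, so every approximate cycle already lies in the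
part `Z_{r-1}^{p+1}` of `B_r^p`. -/
theorem IsFirstQuadrant.subsingleton_of_neg (hA : A.IsFirstQuadrant) {r n p : ℤ} (h : p < 0) :
    Subsingleton (A.E r n p) := by
  refine subsingleton_of_forall_eq 0 fun y => ?_
  obtain ⟨⟨x, hx⟩, rfl⟩ := mkE_surjective y
  rw [mkE_eq_zero]
  refine mem_B.2 ⟨0, zero_mem _, x, ⟨F_le (by omega) (hA.top n p h.le hx.1), ?_⟩, by simp⟩
  exact F_le (by omega) hx.2

variable (A) in
/-- The `r`-th page, with `E_r (p + q) p` in position `(p, q)`. -/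
def page (r : ℤ) : HomologicalComplex (ModuleCat.{u} R)
    (ComplexShape.spectralSequenceNat ⟨r, 1 - r⟩) where
  X pq := ModuleCat.of R (A.E r (pq.1 + pq.2) pq.1)
  d pq pq' := ModuleCat.ofHom (A.dE r (pq.1 + pq.2) pq.1 (pq'.1 + pq'.2) pq'.1)
  shape pq pq' h := by
    have h' : ¬ ((pq'.1 + pq'.2 : ℤ) = pq.1 + pq.2 + 1 ∧ (pq'.1 : ℤ) = pq.1 + r) := by
      rw [ComplexShape.spectralSequenceNat_rel_iff] at h
      dsimp only at h
      omega
    rw [dE, dif_neg h']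
    rfl
  d_comp_d' _ _ _ _ _ := ModuleCat.hom_ext (LinearMap.ext fun y => dE_dE (A := A) y)

/-- The homology of a page is the next page. Where the source or the target of `d_r` falls outside
the first quadrant, the page has no arrow, in agreement with the vanishing of that term. -/
theorem IsFirstQuadrant.nonempty_page_iso (hA : A.IsFirstQuadrant) {r r' : ℤ} (hr : r + 1 = r')
    (pq : ℕ × ℕ) (h0 : 0 < r) : Nonempty ((A.page r).homology pq ≅ (A.page r').X pq) := by
  obtain ⟨p, q⟩ := pq
  refine nonempty_iso_homology (A.page r) (p, q) (A.toE hr (p + q) p)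
    ((A.B r' (p + q) p).submoduleOf (A.Z r' (p + q) p)) (fun y => ?_) fun x => ?_
  · refine (dE_eq_zero_iff (A := A) hr ⟨rfl, rfl⟩ y).symm.trans ?_
    constructor
    · rintro hy ⟨p', q'⟩
      change A.dE r (p + q) p (p' + q') p' y = 0
      by_cases h : ((p' + q' : ℤ) = p + q + 1 ∧ (p' : ℤ) = p + r)
      · rwa [h.1, h.2]
      · rw [dE, dif_neg h]
        rfl
    · intro hy
      by_cases h : r ≤ q + 1
      · have := hy ((p + r).toNat, (q + 1 - r).toNat)
        change A.dE r (p + q) p ((p + r).toNat + (q + 1 - r).toNat : ℤ) ((p + r).toNat : ℤ) y = 0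
          at this
        rwa [show ((p + r).toNat + (q + 1 - r).toNat : ℤ) = p + q + 1 by omega,
          show ((p + r).toNat : ℤ) = p + r by omega] at this
      · -- The target of `d_r` lies below the first quadrant.
        have : Subsingleton (A.E r ((p : ℤ) + q + 1) (p + r)) :=
          hA.subsingleton_of_lt (by omega)
        exact Subsingleton.elim _ _
  · have key := mem_B_iff_exists_dE (A := A) (n' := p + q - 1) (p' := p - r) hr
      ⟨by ring, by ring⟩ x
    refine Iff.trans key ?_
    constructor
    · rintro ⟨y, hy⟩
      by_cases h : r ≤ p
      · refine ⟨((p - r).toNat, (q + r - 1).toNat), ?_⟩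
        change ∃ z : A.E r ((p - r).toNat + (q + r - 1).toNat : ℤ) ((p - r).toNat : ℤ),
          A.dE r _ _ _ _ z = _
        rw [show ((p - r).toNat + (q + r - 1).toNat : ℤ) = p + q - 1 by omega,
          show ((p - r).toNat : ℤ) = p - r by omega]
        exact ⟨y, hy⟩
      · -- The source of `d_r` lies to the left of the first quadrant.
        have : Subsingleton (A.E r ((p : ℤ) + q - 1) (p - r)) :=
          hA.subsingleton_of_neg (by omega)
        rw [Subsingleton.elim y 0, map_zero] at hy
        exact ⟨(p, q), 0, (map_zero _).trans hy⟩
    · rintro ⟨⟨p', q'⟩, z, hz⟩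
      change A.dE r (p' + q') p' (p + q) p z = _ at hz
      by_cases h : ((p + q : ℤ) = p' + q' + 1 ∧ (p : ℤ) = p' + r)
      · rw [show (p + q - 1 : ℤ) = p' + q' by omega, show (p - r : ℤ) = p' by omega]
        exact ⟨z, hz⟩
      · rw [dE, dif_neg h] at hz
        exact ⟨0, (map_zero _).trans hz⟩

/-- The spectral sequence of a first quadrant filtration. -/
def IsFirstQuadrant.spectralSequence (hA : A.IsFirstQuadrant) :
    E₂CohomologicalSpectralSequenceNat (ModuleCat.{u} R) where
  page r _ := A.page r
  iso _ _ pq hrr' hr := (hA.nonempty_page_iso hrr' pq (by omega)).some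

/-- Convergence: `E_r^{p,q}` for large `r` is the quotient of the cycles in `F^p` by those in
`F^{p+1}` and by the boundaries in `F^p`, that is, the graded piece of the filtration of the
homology by the images of the `F^p`. -/
theorem IsFirstQuadrant.convergesTo (hA : A.IsFirstQuadrant) (H : ℕ → ModuleCat.{u} R)
    (h : ∀ n : ℕ, (A.F n 0 ⊓ LinearMap.ker A.d : Submodule R M) →ₗ[R] H n)
    (hs : ∀ n, Function.Surjective (h n))
    (hk : ∀ n x, h n x = 0 ↔ ∃ y ∈ A.F (n - 1) 0, A.d y = x) :
    ConvergesTo hA.spectralSequence H := by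
  let Fil (n p : ℕ) : Submodule R (H n) := ((A.F n p).submoduleOf _).map (h n)
  refine ⟨Fil, fun n p p' hp => ?_, fun n => ?_, fun n => ?_, fun p q => ?_⟩
  · exact Submodule.map_mono fun x hx => F_le (by omega) hx
  · refine eq_top_iff.2 fun y _ => ?_
    obtain ⟨x, rfl⟩ := hs n y
    exact ⟨x, x.2.1, rfl⟩
  · refine eq_bot_iff.2 ?_
    rintro _ ⟨x, hx, rfl⟩
    have hx' : x.1 ∈ A.F n (n + 1 : ℕ) := hx
    rw [hA.bot _ _ (by push_cast; omega), Submodule.mem_bot] at hx'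
    obtain rfl : x = 0 := Subtype.ext hx'
    exact map_zero (h n)
  · -- From `r = p + q + 2` on, `d_r` out of `(p, q)` leaves the quadrant below, and `d_r` into it
    -- would start in a negative column.
    refine ⟨p + q + 2, fun r hr hr' => ⟨fun i => ?_, fun i => ?_, ?_⟩⟩
    · refine HomologicalComplex.shape _ _ _ ?_
      rw [ComplexShape.spectralSequenceNat_rel_iff]
      dsimp only
      omega
    · refine HomologicalComplex.shape _ _ _ ?_
      rw [ComplexShape.spectralSequenceNat_rel_iff]
      dsimp only
      omega
    · have hcyc : ∀ x ∈ A.Z r (p + q) p, x ∈ (A.F (p + q : ℕ) 0 ⊓ LinearMap.ker A.d) := by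
        intro x hx
        exact ⟨by push_cast; exact F_le (by omega) hx.1, hA.d_eq_zero hx (by omega)⟩
      let f : A.Z r (p + q) p →ₗ[R] Fil (p + q) p :=
        (h (p + q) ∘ₗ Submodule.inclusion hcyc).codRestrict _ fun x =>
          ⟨⟨x.1, hcyc _ x.2⟩, by
            have hx : x.1 ∈ A.F (p + q : ℕ) p := by exact_mod_cast x.2.1
            exact hx, rfl⟩
      let g : A.Z r (p + q) p →ₗ[R]
          Fil (p + q) p ⧸ (Fil (p + q) (p + 1)).submoduleOf (Fil (p + q) p) :=
        Submodule.mkQ _ ∘ₗ f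
      have hg : Function.Surjective g := by
        refine (Submodule.mkQ_surjective _).comp ?_
        rintro ⟨_, x, hx, rfl⟩
        have hx' : x.1 ∈ A.F (p + q : ℕ) p := hx
        push_cast at hx'
        exact ⟨⟨x.1, mem_Z_of_d_eq_zero hx' x.2.2⟩, rfl⟩
      have hgk : LinearMap.ker g = (A.B r (p + q) p).submoduleOf (A.Z r (p + q) p) := by
        ext x
        rw [LinearMap.mem_ker, LinearMap.comp_apply, Submodule.mkQ_apply,
          Submodule.Quotient.mk_eq_zero]
        change (h (p + q) ⟨x.1, hcyc _ x.2⟩ ∈ Fil (p + q) (p + 1)) ↔ x.1 ∈ A.B r (p + q) p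
        rw [mem_B]
        constructor
        · rintro ⟨z, hz, hzx⟩
          rw [eq_comm, ← sub_eq_zero, ← map_sub, hk] at hzx
          obtain ⟨y, hy, e⟩ := hzx
          have e' : A.d y + z.1 = x.1 := by
            rw [e]
            exact sub_add_cancel _ _
          have hz' : z.1 ∈ A.F (p + q) (p + 1) := by
            have : z.1 ∈ A.F (p + q : ℕ) (p + 1 : ℕ) := hz
            exact_mod_cast this
          have hz0 : A.d z.1 = 0 := z.2.2
          refine ⟨y, mem_Z.2 ⟨?_, ?_⟩, z.1, mem_Z_of_d_eq_zero hz' hz0, e'⟩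
          · push_cast at hy
            exact F_le (by omega) hy
          · have : A.d y ∈ A.F (p + q) p := by
              rw [eq_sub_of_add_eq e']
              exact sub_mem x.2.1 (F_le (by omega) hz')
            rw [sub_add_cancel]
            exact F_le (by omega) this
        · rintro ⟨y, hy, z, hz, e⟩
          have hz0 : A.d z = 0 := hA.d_eq_zero hz (by omega)
          refine ⟨⟨z, ⟨by push_cast; exact F_le (by omega) hz.1, hz0⟩⟩, ?_, ?_⟩
          · have := hz.1
            change z ∈ A.F (p + q : ℕ) (p + 1 : ℕ)
            exact_mod_cast this
          · rw [eq_comm, ← sub_eq_zero, ← map_sub, hk]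
            refine ⟨y, ?_, ?_⟩
            · push_cast
              exact hA.top _ _ (by omega) hy.1
            · exact eq_sub_of_add_eq e
      exact ⟨((Submodule.quotEquivOfEq _ _ hgk.symm).trans
        (g.quotKerEquivOfSurjective hg)).toModuleIso⟩

end FilteredDiff

/-! ### The column filtration of a double complex -/

/-- A first quadrant double complex of modules with anticommuting differentials. -/
structure DoubleComplex (R : Type w) [CommRing R] (K : ℕ → ℕ → Type u)
    [∀ p q, AddCommGroup (K p q)] [∀ p q, Module R (K p q)] where
  dH : ∀ p q, K p q →ₗ[R] K (p + 1) q
  dV : ∀ p q, K p q →ₗ[R] K p (q + 1)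
  dH_dH : ∀ p q x, dH (p + 1) q (dH p q x) = 0
  dV_dV : ∀ p q x, dV p (q + 1) (dV p q x) = 0
  anticomm : ∀ p q x, dV (p + 1) q (dH p q x) + dH p (q + 1) (dV p q x) = 0

namespace DoubleComplex

variable {R : Type w} [CommRing R] {K : ℕ → ℕ → Type u}
  [∀ p q, AddCommGroup (K p q)] [∀ p q, Module R (K p q)] (D : DoubleComplex R K)

/-- The value in position `(p, q)` of the horizontal differential of a family. -/
def hor : ∀ p q : ℕ, (∀ p q, K p q) →ₗ[R] K p q
  | 0, _ => 0
  | p + 1, q => D.dH p q ∘ₗ LinearMap.proj q ∘ₗ LinearMap.proj p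

/-- The value in position `(p, q)` of the vertical differential of a family. -/
def ver : ∀ p q : ℕ, (∀ p q, K p q) →ₗ[R] K p q
  | _, 0 => 0
  | p, q + 1 => D.dV p q ∘ₗ LinearMap.proj q ∘ₗ LinearMap.proj p

/-- The total differential on families of elements of a double complex in all positions. -/
def d : (∀ p q, K p q) →ₗ[R] (∀ p q, K p q) :=
  LinearMap.pi fun p => LinearMap.pi fun q => D.hor p q + D.ver p q

variable (x : ∀ p q, K p q)

@[simp] theorem hor_zero (q : ℕ) : D.hor 0 q x = 0 := rfl
@[simp] theorem hor_succ (p q : ℕ) : D.hor (p + 1) q x = D.dH p q (x p q) := rfl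
@[simp] theorem ver_zero (p : ℕ) : D.ver p 0 x = 0 := rfl
@[simp] theorem ver_succ (p q : ℕ) : D.ver p (q + 1) x = D.dV p q (x p q) := rfl
theorem d_apply (p q : ℕ) : D.d x p q = D.hor p q x + D.ver p q x := rfl

theorem dH_hor (p q : ℕ) : D.dH p q (D.hor p q x) = 0 := by
  cases p <;> simp [D.dH_dH]

theorem dV_ver (p q : ℕ) : D.dV p q (D.ver p q x) = 0 := by
  cases q <;> simp [D.dV_dV]

theorem d_d : D.d (D.d x) = 0 := by
  funext p q
  rcases p with _ | p <;> rcases q with _ | q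
  · simp [d_apply]
  · simp [d_apply, dV_ver]
  · simp [d_apply, dH_hor]
  · rw [d_apply, hor_succ, ver_succ, d_apply, d_apply, map_add, map_add, dH_hor, dV_ver,
      zero_add, add_zero, hor_succ, ver_succ]
    exact (add_comm _ _).trans (D.anticomm p q _)

variable (R K) in
/-- The families concentrated in total degree `n` and in the columns from `p` on. -/
def colFil (n p : ℤ) : Submodule R (∀ p q, K p q) where
  carrier := {x | ∀ a b : ℕ, ((a : ℤ) + b = n → (a : ℤ) < p) → x a b = 0}
  zero_mem' _ _ _ := rfl
  add_mem' {x y} hx hy a b h := by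
    change x a b + y a b = 0
    rw [hx a b h, hy a b h, add_zero]
  smul_mem' c x hx a b h := by
    change c • x a b = 0
    rw [hx a b h, smul_zero]

/-- The families indexed by `ℕ × ℕ`, with the total differential and the column filtration. -/
def filtered : FilteredDiff R (∀ p q, K p q) where
  d := D.d
  F := colFil R K
  d_d := D.d_d
  F_anti n p p' hp x hx a b h := hx a b fun e => (h e).trans_le hp
  d_mem n p x hx a b h := by
    have h1 : D.hor a b x = 0 := by
      rcases a with _ | a
      · rfl
      · rw [hor_succ, hx a b fun e => ?_, map_zero]
        have := h (by push_cast; omega)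
        push_cast at this
        omega
    have h2 : D.ver a b x = 0 := by
      rcases b with _ | b
      · rfl
      · rw [ver_succ, hx a b fun e => h (by push_cast; omega), map_zero]
    rw [d_apply, h1, h2, add_zero]

theorem isFirstQuadrant : D.filtered.IsFirstQuadrant where
  bot n p h := by
    refine eq_bot_iff.2 fun x hx => ?_
    rw [Submodule.mem_bot]
    funext a b
    exact hx a b (by omega)
  top n p h x hx a b h' := hx a b (by omega)

/-- The restriction of a family to the positions of total degree `n` in columns from `p` on. -/
def trunc (n p : ℤ) (x : ∀ p q, K p q) : ∀ p q, K p q :=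
  fun a b => if (a : ℤ) + b = n → (a : ℤ) < p then 0 else x a b

theorem trunc_mem (n p : ℤ) : trunc n p x ∈ colFil R K n p := fun _ _ h => if_pos h

variable {x}

theorem trunc_apply {n p : ℤ} {a b : ℕ} (h : (a : ℤ) + b = n) (h' : p ≤ a) :
    trunc n p x a b = x a b := if_neg fun h'' => by have := h'' h; omega

/-- The families with the single entry `u` in position `(p, q)`. -/
abbrev single (p q : ℕ) (u : K p q) : ∀ p q, K p q := Pi.single p (Pi.single q u)

theorem single_self (p q : ℕ) (u : K p q) : single p q u p q = u := by simp [single]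

theorem single_of_ne {p q a b : ℕ} (u : K p q) (h : a ≠ p ∨ b ≠ q) : single p q u a b = 0 := by
  by_cases ha : a = p
  · subst ha
    simp [single, h.resolve_left (by simp)]
  · simp [single, ha]

theorem single_mem {n c : ℤ} {p q : ℕ} (u : K p q) (h : (p : ℤ) + q = n) (h' : c ≤ p) :
    single p q u ∈ colFil R K n c := by
  refine fun a b hab => single_of_ne u ?_
  by_contra! hne
  obtain ⟨rfl, rfl⟩ := hne
  have := hab h
  omega

/-- Membership in the next filtration step is the vanishing of one entry. -/
theorem mem_colFil_succ {n : ℤ} {p q : ℕ} (h : (p : ℤ) + q = n) (hx : x ∈ colFil R K n p)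
    (h0 : x p q = 0) : x ∈ colFil R K n (p + 1) := by
  intro a b hab
  by_cases e : a = p ∧ b = q
  · obtain ⟨rfl, rfl⟩ := e
    exact h0
  · exact hx a b (by omega)

variable {D} in
/-- Membership in `Z_2^p` involves only the first two columns of the differential. -/
theorem mem_Z_two {p q : ℕ} : x ∈ D.filtered.Z 2 (p + q) p ↔
    x ∈ colFil R K (p + q) p ∧ D.dV p q (x p q) = 0 ∧
      D.dH p q (x p q) + D.ver (p + 1) q x = 0 := by
  have hhor : x ∈ colFil R K (p + q) p → D.hor p (q + 1) x = 0 := by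
    intro hx
    rcases p with _ | p
    · rfl
    · rw [hor_succ, hx p (q + 1) (by push_cast; omega), map_zero]
  rw [FilteredDiff.mem_Z]
  refine and_congr_right fun hx => ?_
  constructor
  · intro h
    have h1 := h p (q + 1) (by push_cast; omega)
    have h2 := h (p + 1) q (by push_cast; omega)
    change D.d x _ _ = 0 at h1 h2
    rw [d_apply, ver_succ, hhor hx, zero_add] at h1
    exact ⟨h1, h2⟩
  · rintro ⟨h1, h2⟩
    have e0 : D.d x ∈ colFil R K (p + q + 1) p := D.filtered.d_mem _ _ _ hx
    have e1 := mem_colFil_succ (p := p) (q := q + 1) (by push_cast; ring) e0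
      (by rw [d_apply, ver_succ, hhor hx, zero_add, h1])
    have e2 := mem_colFil_succ (n := p + q + 1) (p := p + 1) (q := q) (by push_cast; ring)
      (by exact_mod_cast e1) h2
    rw [show ((p + 1 : ℕ) + 1 : ℤ) = p + 2 by push_cast; ring] at e2
    exact e2

/-- The `E_2` term of a double complex as the homology of a complex `C` which is a quotient of the
complex `W` of vertical cycles in row `q`, embedded by `i`, with kernel the vertical boundaries. -/
theorem nonempty_iso_E_two (q : ℕ) {W C : CochainComplex (ModuleCat.{u} R) ℕ} (π : W ⟶ C)
    (i : ∀ p, W.X p →ₗ[R] K p q) (hi : ∀ p, Function.Injective (i p))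
    (hir : ∀ p x, (∃ w, i p w = x) ↔ D.dV p q x = 0)
    (hid : ∀ p w, D.dH p q (i p w) =
      (-1 : ℤ) ^ (p + 1 + q) • i (p + 1) ((W.d p (p + 1)).hom w))
    (hπ : ∀ p, Function.Surjective (π.f p).hom)
    (hπk : ∀ p w, (π.f p).hom w = 0 ↔ ∃ v, D.ver p q v = i p w) (p : ℕ) :
    Nonempty ((D.isFirstQuadrant.spectralSequence.page 2).X (p, q) ≅ C.homology p) := by
  -- The leading entry of an element of `Z_2`, as an element of `W`.
  have hcyc : ∀ x : D.filtered.Z 2 (p + q) p, ∃ w, i p w = x.1 p q := fun x =>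
    (hir _ _).2 (mem_Z_two.1 x.2).2.1
  choose f hf using hcyc
  let φ : D.filtered.Z 2 (p + q) p →ₗ[R] W.X p :=
    { toFun := f
      map_add' x y := hi p (by rw [map_add, hf, hf, hf]; rfl)
      map_smul' c x := hi p (by rw [map_smul, hf, hf]; rfl) }
  have hφ : ∀ x, i p (φ x) = x.1 p q := hf
  have hcomm : ∀ p w, (C.d p (p + 1)).hom ((π.f p).hom w) =
      (π.f (p + 1)).hom ((W.d p (p + 1)).hom w) := fun p w =>
    (congrArg (fun g => g.hom w) (π.comm p (p + 1)))
  have hd : ∀ p w, i (p + 1) ((W.d p (p + 1)).hom w) =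
      (-1 : ℤ) ^ (p + 1 + q) • D.dH p q (i p w) := by
    intro p w
    rw [hid, smul_smul, ← mul_pow]
    simp
  refine (nonempty_iso_homology C p ((π.f p).hom ∘ₗ φ)
    ((D.filtered.B 2 (p + q) p).submoduleOf (D.filtered.Z 2 (p + q) p)) ?_ ?_).map Iso.symm
  · intro y
    constructor
    · rintro ⟨x, rfl⟩ j'
      by_cases hj : p + 1 = j'
      · subst hj
        refine (hcomm p _).trans ((hπk _ _).2 ?_)
        refine ⟨(-1 : ℤ) ^ (p + 1 + q) • (-x.1), ?_⟩
        rw [hd, hφ, map_zsmul, map_neg, eq_neg_of_add_eq_zero_left (mem_Z_two.1 x.2).2.2]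
      · rw [C.shape _ _ hj]
        rfl
    · intro hy
      obtain ⟨w, rfl⟩ := hπ p y
      have h0 := hy (p + 1)
      rw [hcomm, hπk] at h0
      obtain ⟨v, hv⟩ := h0
      -- Correct the vertical cycle `i w` by an entry in the next column.
      let v' : ∀ p q, K p q := trunc (p + q) (p + 1) ((-1 : ℤ) ^ (p + 1 + q) • v)
      have hv' : D.ver (p + 1) q v' = D.dH p q (i p w) := by
        have e : D.ver (p + 1) q v' = (-1 : ℤ) ^ (p + 1 + q) • D.ver (p + 1) q v := by
          rw [← map_zsmul]
          rcases q with _ | q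
          · rfl
          · rw [ver_succ, ver_succ]
            congr 1
            exact trunc_apply (by push_cast; ring) (by push_cast; rfl)
        rw [e, hv, hid]
      have hpq : (single p q (i p w) - v') p q = i p w := by
        change single p q (i p w) p q - v' p q = _
        have h0 : v' p q = 0 := trunc_mem (R := R) _ _ _ p q (by omega)
        rw [single_self, h0, sub_zero]
      have hver : D.ver (p + 1) q (single p q (i p w)) = 0 := by
        rcases q with _ | q
        · rfl
        · rw [ver_succ, single_of_ne _ (by simp), map_zero]
      refine ⟨⟨single p q (i p w) - v', mem_Z_two.2 ⟨?_, ?_, ?_⟩⟩, ?_⟩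
      · exact sub_mem (single_mem _ rfl le_rfl)
          (FilteredDiff.F_le (A := D.filtered) (by omega) (trunc_mem (R := R) _ _ _))
      · rw [hpq]
        exact (hir _ _).1 ⟨w, rfl⟩
      · rw [hpq, map_sub, hver, hv', zero_sub, add_neg_cancel]
      · rw [LinearMap.comp_apply]
        congr 1
        exact hi p ((hφ _).trans hpq)
  · intro x
    have hB : x ∈ (D.filtered.B 2 (p + q) p).submoduleOf (D.filtered.Z 2 (p + q) p) ↔
        ∃ y ∈ D.filtered.Z (2 - 1) (p + q - 1) (p - 2 + 1),
          ∃ z ∈ D.filtered.Z (2 - 1) (p + q) (p + 1), D.d y + z = x.1 :=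
      FilteredDiff.mem_B
    rw [hB]
    constructor
    · rintro ⟨y, hy, z, hz, e⟩
      have hz0 : z p q = 0 := hz.1 p q (by omega)
      have hpq : x.1 p q = D.hor p q y + D.ver p q y := by
        rw [← e, ← d_apply]
        change D.d y p q + z p q = _
        rw [hz0, add_zero]
      rcases p with _ | p
      · refine ⟨0, 0, ?_⟩
        rw [map_zero, eq_comm]
        refine (hπk 0 _).2 ⟨y, ?_⟩
        rw [hφ, hpq, hor_zero, zero_add]
      · have hyc : D.dV p q (y p q) = 0 := by
          have h1 : D.d y p (q + 1) = 0 := hy.2 p (q + 1) (by push_cast; omega)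
          have h2 : D.hor p (q + 1) y = 0 := by
            rcases p with _ | p
            · rfl
            · rw [hor_succ, hy.1 p (q + 1) (by push_cast; omega), map_zero]
          rwa [d_apply, h2, zero_add] at h1
        obtain ⟨w, hw⟩ := (hir _ _).2 hyc
        refine ⟨p, (-1 : ℤ) ^ (p + 1 + q) • (π.f p).hom w, ?_⟩
        rw [map_zsmul, hcomm, ← map_zsmul, eq_comm, ← sub_eq_zero, LinearMap.comp_apply,
          ← map_sub, hπk]
        refine ⟨y, ?_⟩
        rw [map_sub, hφ, hpq, hor_succ, map_zsmul, ← hid, hw, add_sub_cancel_left]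
    · rintro ⟨j', z, hz⟩
      -- Up to a vertical boundary, the leading entry of `x` is `d_H` of a vertical cycle `c`.
      obtain ⟨c, hcF, hcd, hcv, v, hv⟩ : ∃ c ∈ colFil R K (p + q - 1) (p - 1),
          D.d c ∈ colFil R K (p + q) p ∧ D.ver p q c = 0 ∧
          ∃ v, x.1 p q = D.hor p q c + D.ver p q v := by
        by_cases hj : j' + 1 = p
        · subst hj
          obtain ⟨w, rfl⟩ := hπ _ z
          rw [hcomm, eq_comm, ← sub_eq_zero, LinearMap.comp_apply, ← map_sub, hπk] at hz
          obtain ⟨v, hv⟩ := hz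
          let c : ∀ p q, K p q := single j' q ((-1 : ℤ) ^ (j' + 1 + q) • i j' w)
          have hc : c j' q = (-1 : ℤ) ^ (j' + 1 + q) • i j' w := single_self _ _ _
          have hc0 : ∀ {a b}, a ≠ j' ∨ b ≠ q → c a b = 0 := fun h => single_of_ne _ h
          have hcF : c ∈ colFil R K (j' + q) j' := single_mem _ rfl le_rfl
          refine ⟨c, ?_, ?_, ?_, v, ?_⟩
          · convert hcF using 2 <;> push_cast <;> ring
          · have h0 : D.hor j' (q + 1) c = 0 := by
              rcases j' with _ | j'
              · rfl
              · rw [hor_succ, hc0 (by simp), map_zero]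
            have := mem_colFil_succ (n := j' + q + 1) (p := j') (q := q + 1) (by push_cast; ring)
              (D.filtered.d_mem _ _ _ hcF) (by
                change D.d c _ _ = 0
                rw [d_apply, h0, zero_add, ver_succ, hc, map_zsmul, (hir _ _).1 ⟨w, rfl⟩,
                  smul_zero])
            rw [show ((j' + 1 : ℕ) + q : ℤ) = j' + q + 1 by push_cast; ring, Nat.cast_succ]
            exact this
          · rcases q with _ | q
            · rfl
            · rw [ver_succ, hc0 (by simp), map_zero]
          · rw [hor_succ, hc, map_zsmul, ← hd, hv, map_sub, hφ, add_sub_cancel]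
        · rw [C.shape _ _ hj] at hz
          obtain ⟨v, hv⟩ := (hπk _ _).1 (show (π.f p).hom (φ x) = 0 from hz.symm)
          refine ⟨0, zero_mem _, ?_, map_zero _, v, by rw [map_zero, hv, hφ, zero_add]⟩
          rw [map_zero]
          exact zero_mem _
      let v' : ∀ p q, K p q := trunc (p + q - 1) p v
      have hvF : v' ∈ colFil R K (p + q - 1) p := trunc_mem (R := R) _ _ _
      have hv' : D.ver p q v' = D.ver p q v := by
        rcases q with _ | q
        · rfl
        · rw [ver_succ, ver_succ]
          congr 1
          exact trunc_apply (by push_cast; ring) le_rfl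
      have hhv : D.hor p q v' = 0 := by
        rcases p with _ | p
        · rfl
        · rw [hor_succ, hvF p q (by push_cast; omega), map_zero]
      have hvd : D.d v' ∈ colFil R K (p + q) p := by
        have := D.filtered.d_mem _ _ _ hvF
        rwa [sub_add_cancel] at this
      have hyd : D.d (c + v') ∈ colFil R K (p + q) p := by
        rw [map_add]
        exact add_mem hcd hvd
      refine ⟨c + v', FilteredDiff.mem_Z.2 ⟨?_, ?_⟩, x.1 - D.d (c + v'),
        FilteredDiff.mem_Z.2 ⟨?_, ?_⟩, add_sub_cancel _ _⟩
      · rw [show (p - 2 + 1 : ℤ) = p - 1 by ring]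
        exact add_mem hcF (FilteredDiff.F_le (A := D.filtered) (by omega) hvF)
      · rw [sub_add_cancel]
        exact FilteredDiff.F_le (A := D.filtered) (by omega) hyd
      · refine mem_colFil_succ (q := q) rfl (sub_mem x.2.1 hyd) ?_
        change x.1 p q - D.d (c + v') p q = 0
        rw [d_apply, map_add, map_add, hcv, hhv, hv', hv, add_zero, zero_add, sub_self]
      · have e : D.filtered.d (x.1 - D.d (c + v')) = D.filtered.d x.1 := by
          rw [map_sub]
          exact (congrArg _ (D.d_d _)).trans (sub_zero _)
        rw [e]
        exact FilteredDiff.F_le (by omega) x.2.2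

end DoubleComplex

/-! ### Cycles and boundaries in complexes of modules -/

section Cycles

variable {R : Type w} [CommRing R] {κ : Type*} {c : ComplexShape κ}
  (K : HomologicalComplex (ModuleCat.{u} R) c)

theorem iCycles_injective (j : κ) : Function.Injective (K.iCycles j).hom :=
  (ModuleCat.mono_iff_injective _).1 inferInstance

theorem homologyπ_surjective (j : κ) : Function.Surjective (K.homologyπ j).hom :=
  (ModuleCat.epi_iff_surjective _).1 inferInstance

theorem exists_iCycles_eq_iff {j k : κ} (hk : c.next j = k) (x : K.X j) :
    (∃ z, (K.iCycles j).hom z = x) ↔ (K.d j k).hom x = 0 := by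
  have h := ShortComplex.exact_of_f_is_kernel
    (ShortComplex.mk (K.iCycles j) (K.d j k) (K.iCycles_d j k)) (K.cyclesIsKernel j k hk)
  rw [ShortComplex.moduleCat_exact_iff] at h
  refine ⟨?_, h x⟩
  rintro ⟨z, rfl⟩
  exact congrArg (fun f => f.hom z) (K.iCycles_d j k)

theorem homologyπ_eq_zero_iff {i j : κ} (hi : c.prev j = i) (z : K.cycles j) :
    (K.homologyπ j).hom z = 0 ↔ ∃ y, (K.d i j).hom y = (K.iCycles j).hom z := by
  have h := ShortComplex.exact_of_g_is_cokernel
    (ShortComplex.mk (K.toCycles i j) (K.homologyπ j) (K.toCycles_comp_homologyπ i j))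
    (K.homologyIsCokernel i j hi)
  rw [ShortComplex.moduleCat_exact_iff] at h
  have hd : ∀ y, (K.iCycles j).hom ((K.toCycles i j).hom y) = (K.d i j).hom y := fun y =>
    congrArg (fun f => f.hom y) (K.toCycles_i i j)
  constructor
  · intro hz
    obtain ⟨y, rfl⟩ := h z hz
    exact ⟨y, (hd y).symm⟩
  · rintro ⟨y, hy⟩
    obtain rfl := iCycles_injective K j ((hd y).trans hy)
    exact congrArg (fun f => f.hom y) (K.toCycles_comp_homologyπ i j)

end Cycles

/-! ### The double complex of a bundle of sheaves -/

namespace SheafBundle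

variable {R : Type w} [CommRing R] {B : Type u} [SmallCategory B] (ξ : SheafBundle R B)

/-- The double complex `𝒦^{p,q} = 𝒮^p(B, 𝒮^q)`. -/
def doubleComplex : DoubleComplex R (fun p q => ξ.bicomplex p q) where
  dH p q := (ξ.dHor p q).hom
  dV p q := (ξ.dVert p q).hom
  dH_dH p q x := congrArg (fun f => f.hom x) (ξ.dHor_dHor p q)
  dV_dV p q x := congrArg (fun f => f.hom x) (ξ.dVert_dVert p q)
  anticomm p q x := congrArg (fun f => f.hom x) (ξ.dHor_dVert p q)

/-- The entries of a family in total degree `n`. -/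
def toTotal (n : ℕ) : (∀ p q : ℕ, ξ.bicomplex p q) →ₗ[R] ξ.totalX n :=
  LinearMap.pi fun i => LinearMap.proj i.1.2 ∘ₗ LinearMap.proj i.1.1

theorem totalD_toTotal (n : ℕ) (x : ∀ p q : ℕ, ξ.bicomplex p q) :
    (ξ.totalD n).hom (ξ.toTotal n x) = ξ.toTotal (n + 1) (ξ.doubleComplex.d x) := by
  funext ⟨⟨p, q⟩, h⟩
  have h' := Finset.HasAntidiagonal.mem_antidiagonal.1 h
  have h1 : (ξ.totalHor p q h').hom (ξ.toTotal n x) = ξ.doubleComplex.hor p q x := by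
    cases p <;> rfl
  have h2 : (ξ.totalVert p q h').hom (ξ.toTotal n x) = ξ.doubleComplex.ver p q x := by
    cases p <;> cases q <;> rfl
  exact congrArg₂ (· + ·) h1 h2

theorem eq_zero_of_toTotal_eq_zero {n : ℕ} {x : ∀ p q : ℕ, ξ.bicomplex p q}
    (hx : x ∈ ξ.doubleComplex.filtered.F n 0) (h : ξ.toTotal n x = 0) : x = 0 := by
  funext p q
  by_cases e : p + q = n
  · exact congrFun h ⟨(p, q), Finset.HasAntidiagonal.mem_antidiagonal.2 e⟩
  · exact hx p q (by omega)

theorem exists_toTotal_eq {n : ℕ} (y : ξ.totalX n) :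
    ∃ x ∈ ξ.doubleComplex.filtered.F n 0, ξ.toTotal n x = y := by
  refine ⟨fun p q => if h : p + q = n then
    y ⟨(p, q), Finset.HasAntidiagonal.mem_antidiagonal.2 h⟩ else 0, fun p q h => ?_, ?_⟩
  · exact dif_neg (by omega)
  · funext ⟨⟨p, q⟩, h⟩
    exact dif_pos (Finset.HasAntidiagonal.mem_antidiagonal.1 h)

theorem totalComplex_d (n : ℕ) : ξ.totalComplex.d n (n + 1) = ξ.totalD n :=
  CochainComplex.of_d (X := ξ.totalX) (d := ξ.totalD) (j := n)

/-- The cohomology of the total complex is the cohomology, degree by degree, of the families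
indexed by `ℕ × ℕ`. -/
theorem exists_linearMap_totalComplex_homology (n : ℕ) :
    ∃ h : (ξ.doubleComplex.filtered.F n 0 ⊓ LinearMap.ker ξ.doubleComplex.filtered.d :
        Submodule R (∀ p q : ℕ, ξ.bicomplex p q)) →ₗ[R] ξ.totalComplex.homology n,
      Function.Surjective h ∧ ∀ x, h x = 0 ↔
        ∃ y ∈ ξ.doubleComplex.filtered.F (n - 1) 0, ξ.doubleComplex.filtered.d y = x := by
  set A := ξ.doubleComplex.filtered
  have hd : ∀ (n : ℕ) (x : ∀ p q : ℕ, ξ.bicomplex p q),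
      (ξ.totalComplex.d n (n + 1)).hom (ξ.toTotal n x) = ξ.toTotal (n + 1) (A.d x) := by
    intro n x
    rw [totalComplex_d]
    exact ξ.totalD_toTotal n x
  have key := exists_linearMap_homology ξ.totalComplex n
    (N := (A.F n 0 ⊓ LinearMap.ker A.d : Submodule R (∀ p q : ℕ, ξ.bicomplex p q)))
    (ξ.toTotal n ∘ₗ Submodule.subtype _)
    (((A.F (n - 1) 0).map A.d).submoduleOf _)
  refine Exists.imp (fun h ⟨hs, hk⟩ => ⟨hs, fun x => ?_⟩) (key ?_ ?_)
  · intro y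
    constructor
    · rintro ⟨x, rfl⟩ j'
      by_cases hj : n + 1 = j'
      · subst hj
        have h0 : A.d x.1 = 0 := x.2.2
        refine (hd n x.1).trans ?_
        rw [h0, map_zero]
        rfl
      · rw [ξ.totalComplex.shape _ _ hj]
        rfl
    · intro hy
      obtain ⟨x, hx, rfl⟩ := ξ.exists_toTotal_eq y
      refine ⟨⟨x, hx, ?_⟩, rfl⟩
      refine ξ.eq_zero_of_toTotal_eq_zero (n := n + 1) ?_ ((hd n x).symm.trans (hy _))
      exact_mod_cast A.d_mem _ _ _ hx
  · intro x
    constructor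
    · rintro ⟨y, hy, e⟩
      rcases n with _ | n
      · have h0 : y = 0 := by
          funext p q
          exact hy p q (by push_cast; omega)
        rw [h0, map_zero] at e
        obtain rfl : x = 0 := Subtype.ext e.symm
        exact ⟨0, 0, (map_zero _).trans (map_zero _).symm⟩
      · refine ⟨n, ξ.toTotal n y, (hd n y).trans ?_⟩
        rw [e]
        rfl
    · rintro ⟨j', z, hz⟩
      by_cases hj : j' + 1 = n
      · subst hj
        obtain ⟨y, hy, rfl⟩ := ξ.exists_toTotal_eq z
        refine ⟨y, ?_, ?_⟩
        · rw [Nat.cast_succ, add_sub_cancel_right]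
          exact hy
        · rw [hd] at hz
          refine sub_eq_zero.1 (ξ.eq_zero_of_toTotal_eq_zero (n := j' + 1) ?_ ?_)
          · exact sub_mem (by exact_mod_cast A.d_mem _ _ _ hy) x.2.1
          · rw [map_sub, sub_eq_zero]
            exact hz
      · rw [ξ.totalComplex.shape _ _ hj] at hz
        have h0 := ξ.eq_zero_of_toTotal_eq_zero x.2.1 hz.symm
        exact ⟨0, zero_mem _, (map_zero _).trans h0.symm⟩
  · rw [← LinearMap.mem_ker, hk]
    rfl

/-- The sheaf `x ↦ Z^q(E_x, F_x)` of fibrewise cocycles. -/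
def cocycleSheaf (q : ℕ) : Bᵒᵖ ⥤ ModuleCat.{u} R :=
  ξ ⋙ Sh.cochains ⋙ HomologicalComplex.cyclesFunctor (ModuleCat.{u} R) (ComplexShape.up ℕ) q

/-- The inclusion of the fibrewise cocycles into the cochains. -/
def cocycleInclusion (q : ℕ) : ξ.cocycleSheaf q ⟶ ξ.cochainSheaf q where
  app x := (Sh.cochains.obj (ξ.obj x)).iCycles q
  naturality _ _ f := HomologicalComplex.cyclesMap_i (Sh.cochains.map (ξ.map f)) q

/-- The projection of the fibrewise cocycles to the cohomology of the fibres. -/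
def cocycleProjection (q : ℕ) : ξ.cocycleSheaf q ⟶ ξ.fibreCohomology q where
  app x := (Sh.cochains.obj (ξ.obj x)).homologyπ q
  naturality _ _ f := (HomologicalComplex.homologyπ_naturality (Sh.cochains.map (ξ.map f)) q).symm

/-- The second page. A morphism of sheaves on `B` acts on `𝒮^p(B, -)` simplex by simplex, so the
inclusion of the fibrewise cocycles and the projection to the fibre cohomology keep, after choices
on all simplices, the exactness they have in each fibre. -/
theorem nonempty_page_two_iso (p q : ℕ) :
    Nonempty ((ξ.doubleComplex.isFirstQuadrant.spectralSequence.page 2).X (p, q) ≅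
      (Sh.cohomology p).obj ((Sh.sheafOn B).obj (ξ.fibreCohomology q))) := by
  refine ξ.doubleComplex.nonempty_iso_E_two q
    (Sh.cochains.map ((Sh.sheafOn B).map (ξ.cocycleProjection q)))
    (fun p => ((Sh.cochains.map ((Sh.sheafOn B).map (ξ.cocycleInclusion q))).f p).hom)
    (fun p u v h => ?_) (fun p x => ?_) (fun p w => ?_) (fun p y => ?_) (fun p w => ?_) p
  · funext σ
    exact iCycles_injective _ _ (congrFun h σ)
  · have key := fun σ : ComposableArrows B p => exists_iCycles_eq_iff
      (Sh.cochains.obj (ξ.obj (Opposite.op (σ.obj 0)))) (j := q) (CochainComplex.next ℕ q)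
      ((show ∀ σ : ComposableArrows B p, (ξ.cochainSheaf q).obj (Opposite.op (σ.obj 0)) from x) σ)
    constructor
    · rintro ⟨w, rfl⟩
      funext σ
      exact (key σ).1 ⟨_, rfl⟩
    · intro h
      choose w hw using fun σ => (key σ).2 (congrFun h σ)
      exact ⟨w, funext hw⟩
  · have h := congrArg (fun f => f.hom w)
      ((Sh.cochains.map ((Sh.sheafOn B).map (ξ.cocycleInclusion q))).comm p (p + 1))
    exact congrArg (fun z => (-1 : ℤ) ^ (p + 1 + q) • z) h
  · choose w hw using fun σ : ComposableArrows B p =>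
      homologyπ_surjective (Sh.cochains.obj (ξ.obj (Opposite.op (σ.obj 0)))) q
        ((show ∀ σ : ComposableArrows B p,
          (ξ.fibreCohomology q).obj (Opposite.op (σ.obj 0)) from y) σ)
    exact ⟨w, funext hw⟩
  · let w' : ∀ σ : ComposableArrows B p, (ξ.cocycleSheaf q).obj (Opposite.op (σ.obj 0)) := w
    have key : ((Sh.cochains.map ((Sh.sheafOn B).map (ξ.cocycleProjection q))).f p).hom w = 0 ↔
        ∀ σ : ComposableArrows B p, ∃ y, ((Sh.cochains.obj (ξ.obj (Opposite.op (σ.obj 0)))).d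
          ((ComplexShape.up ℕ).prev q) q).hom y =
          ((Sh.cochains.obj (ξ.obj (Opposite.op (σ.obj 0)))).iCycles q).hom (w' σ) := by
      have key' := fun σ : ComposableArrows B p => homologyπ_eq_zero_iff
        (Sh.cochains.obj (ξ.obj (Opposite.op (σ.obj 0)))) (j := q) rfl (w' σ)
      exact ⟨fun h σ => (key' σ).1 (congrFun h σ), fun h => funext fun σ => (key' σ).2 (h σ)⟩
    rw [key]
    rcases q with _ | q
    · have hrel : ¬ (ComplexShape.up ℕ).Rel ((ComplexShape.up ℕ).prev 0) 0 := Nat.succ_ne_zero _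
      have hd : ∀ σ : ComposableArrows B p, (Sh.cochains.obj (ξ.obj (Opposite.op (σ.obj 0)))).d
          ((ComplexShape.up ℕ).prev 0) 0 = 0 := fun σ =>
        HomologicalComplex.shape _ _ _ hrel
      simp only [hd]
      constructor
      · intro h
        refine ⟨0, funext fun σ => ?_⟩
        obtain ⟨y, hy⟩ := h σ
        exact hy
      · rintro ⟨v, hv⟩ σ
        exact ⟨0, congrFun hv σ⟩
    · rw [CochainComplex.prev_nat_succ]
      constructor
      · intro h
        choose y hy using h
        let y' : ξ.bicomplex p q := y
        refine ⟨DoubleComplex.single p q y', ?_⟩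
        rw [DoubleComplex.ver_succ, DoubleComplex.single_self]
        exact funext hy
      · rintro ⟨v, hv⟩ σ
        rw [DoubleComplex.ver_succ] at hv
        let v' : ∀ σ : ComposableArrows B p, (ξ.cochainSheaf q).obj (Opposite.op (σ.obj 0)) :=
          v p q
        exact ⟨v' σ, congrFun hv σ⟩

end SheafBundle

end

theorem mainTheorem2 {R : Type w} [CommRing R] {B : Type u} [SmallCategory B]
    (ξ : SheafBundle R B) :
    ∃ E : E₂CohomologicalSpectralSequenceNat (ModuleCat.{u} R),
      (∀ p q : ℕ, Nonempty ((E.page 2 le_rfl).X (p, q) ≅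
        (Sh.cohomology p).obj ((Sh.sheafOn B).obj (ξ.fibreCohomology q)))) ∧
      ConvergesTo E (fun n => ξ.totalComplex.homology n) := by
  choose h hs hk using ξ.exists_linearMap_totalComplex_homology
  exact ⟨ξ.doubleComplex.isFirstQuadrant.spectralSequence, ξ.nonempty_page_two_iso,
    ξ.doubleComplex.isFirstQuadrant.convergesTo _ h hs hk⟩
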